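/- Let $\mathcal H$ be an infinite-dimensional complex Hilbert space (not necessarily separable), let $m, q$ be integers with $q\ge 1$, and let $\mathbf A=(A_1,\dots,A_m)$ be an $m$-tuple of bounded self-adjoint operators on $\mathcal H$. For an $m$-tuple $\mathbf B=(B_1,\dots,B_m)$ of bounded operators on a Hilbert space $\mathcal G$, let $\Lambda_{\infty,q}(\mathbf B)$ be the set of all $m$-tuples $(C_1,\dots,C_m)$ of complex $q\times q$ matrices for which there is an isometry $X:\ell^2(\mathbb N;\mathbb C^q)\to\mathcal G$ with $$X^*B_jX = I_\infty\otimes C_j = C_j\oplus C_j\oplus C_j\oplus\cdots\qquad (j=1,\dots,m);$$ that is, the $I_\infty\otimes C_j$ are simultaneously compressions of the $B_j$ to one infinite-dimensional closed subspace of $\mathcal G$. Let $\mathcal L$ be a finite-dimensional subspace of $\mathcal H$ and let $Y_0:\mathcal L^\perp\to\mathcal H$ be an isometry ($Y_0^*Y_0=I_{\mathcal L^\perp}$) whose range has finite codimension in $\mathcal H$. Let $\mathbf F_0=(F_1,\dots,F_m)$ be an $m$-tuple of self-adjoint operators of finite rank on $\mathcal H$. Then $$\Lambda_{\infty,q}(\mathbf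 A)=\Lambda_{\infty,q}(Y_0^*\mathbf A Y_0)=\Lambda_{\infty,q}(\mathbf A+\mathbf F_0),$$ where $Y_0^*\mathbf A Y_0=(Y_0^*A_1Y_0,\dots,Y_0^*A_mY_0)$ is a tuple of operators on $\mathcal L^\perp$ and $\mathbf A+\mathbf F_0=(A_1+F_1,\dots,A_m+F_m)$. -/

import Mathlib

noncomputable section

open scoped InnerProductSpace InnerProduct

/-- The Hilbert space `ℓ²(ℕ; ℂ^q)`, that is `ℂ^q ⊕ ℂ^q ⊕ ⋯` (countably many orthogonal copies). -/
abbrev L2Copies (q : ℕ) : Type :=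
  lp (fun _ : ℕ => EuclideanSpace ℂ (Fin q)) 2

/-- The operator `I_∞ ⊗ B = B ⊕ B ⊕ ⋯` on `ℓ²(ℕ; ℂ^q)`, sending `(v₀, v₁, …)` to
`(B v₀, B v₁, …)`. -/
def infAmpliation {q : ℕ} (B : Matrix (Fin q) (Fin q) ℂ) : L2Copies q →L[ℂ] L2Copies q :=
  LinearMap.mkContinuous
    { toFun := fun v =>
        ⟨fun n => Matrix.toEuclideanCLM (𝕜 := ℂ) B (v n),
          Memℓp.mono' (((lp.memℓp v).const_smul ‖Matrix.toEuclideanCLM (𝕜 := ℂ) B‖))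
            (fun n => by
              simpa [norm_smul] using
                (Matrix.toEuclideanCLM (𝕜 := ℂ) B).le_opNorm (v n))⟩
      map_add' := fun v w => by
        ext1; funext n
        exact map_add (Matrix.toEuclideanCLM (𝕜 := ℂ) B) (v n) (w n)
      map_smul' := fun c v => by
        ext1; funext n
        exact map_smul (Matrix.toEuclideanCLM (𝕜 := ℂ) B) c (v n) }
    ‖Matrix.toEuclideanCLM (𝕜 := ℂ) B‖
    (fun v => by
      have h : ‖((‖Matrix.toEuclideanCLM (𝕜 := ℂ) B‖ : ℝ) • v : L2Copies q)‖
          = ‖Matrix.toEuclideanCLM (𝕜 := ℂ) B‖ * ‖v‖ := by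
        rw [norm_smul, norm_norm]
      rw [← h]
      refine lp.norm_mono (by norm_num) (fun n => ?_)
      simpa [norm_smul] using (Matrix.toEuclideanCLM (𝕜 := ℂ) B).le_opNorm (v n))

theorem infAmpliation_apply {q : ℕ} (B : Matrix (Fin q) (Fin q) ℂ) (v : L2Copies q) (n : ℕ) :
    infAmpliation B v n = Matrix.toEuclideanCLM (𝕜 := ℂ) B (v n) := rfl

/-- The operator `X* A X` on `K`, for an isometry `X : K → H` and a bounded operator `A` on `H`:
the compression of `A` to the closed subspace `X(K)`, transported to `K` by `X`. -/
def compression {K H : Type*} [NormedAddCommGroup K] [InnerProductSpace ℂ K] [CompleteSpace K]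
    [NormedAddCommGroup H] [InnerProductSpace ℂ H] [CompleteSpace H]
    (X : K →ₗᵢ[ℂ] H) (A : H →L[ℂ] H) : K →L[ℂ] K :=
  ContinuousLinearMap.adjoint X.toContinuousLinearMap ∘L A ∘L X.toContinuousLinearMap

/-- The joint `(∞, q)`-matricial range `Λ_{∞,q}(A)`: the `m`-tuples `(C₁, …, C_m)` of complex
`q × q` matrices such that, with one and the same isometry `X` from `ℓ²(ℕ; ℂ^q)` into `H`
(equivalently, one closed subspace `X(ℓ²(ℕ; ℂ^q))` of `H`, of infinite dimension when `0 < q`,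
and one identification of it with `ℂ^q ⊕ ℂ^q ⊕ ⋯`), `X* A_j X = I_∞ ⊗ C_j` for all `j`. -/
def matricialRangeInf {H : Type*} [NormedAddCommGroup H] [InnerProductSpace ℂ H]
    [CompleteSpace H] {m : ℕ} (q : ℕ) (A : Fin m → H →L[ℂ] H) :
    Set (Fin m → Matrix (Fin q) (Fin q) ℂ) :=
  {C | ∃ X : L2Copies q →ₗᵢ[ℂ] H, ∀ j, compression X (A j) = infAmpliation (C j)}

end

open scoped InnerProductSpace

/-! A realizing isometry `X` can be pushed into any closed subspace `M` of finite codimension. For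
an isometry `W` of `ℓ²`, `W ⊗ I_q` commutes with every `I_∞ ⊗ C_j`, so `X (W ⊗ I_q)` realizes the
same tuple; finite codimension of `M` leaves enough freedom to choose `W` so that the new range lies
in `M` (`exists_isometry_range_le`). With `M` the range of `Y₀`, the isometry factors through `Y₀`;
with `M` the common kernel of the `F_j`, the perturbation is invisible. -/

/-- The elementary tensor `w ⊗ x = (w₀ x, w₁ x, …)` in `ℓ²(ℕ; ℂ^q)`, bilinear in `w` and `x`. -/
noncomputable def l2Tensor (q : ℕ) :
    lp (fun _ : ℕ => ℂ) 2 →ₗ[ℂ] EuclideanSpace ℂ (Fin q) →ₗ[ℂ] L2Copies q :=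
  LinearMap.mk₂ ℂ
    (fun w x => ⟨fun n => w n • x,
      Memℓp.mono' ((lp.memℓp w).const_smul ‖x‖) (fun n => by
        simp [norm_smul, mul_comm])⟩)
    (fun w w' x => by ext1; funext n; exact add_smul (w n) (w' n) x)
    (fun c w x => by ext1; funext n; exact mul_smul c (w n) x)
    (fun w x y => by ext1; funext n; exact smul_add (w n) x y)
    (fun c w x => by ext1; funext n; exact smul_comm (w n) c x)

theorem l2Tensor_apply {q : ℕ} (w : lp (fun _ : ℕ => ℂ) 2) (x : EuclideanSpace ℂ (Fin q))
    (n : ℕ) : l2Tensor q w x n = w n • x := rfl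

theorem inner_l2Tensor {q : ℕ} (w w' : lp (fun _ : ℕ => ℂ) 2)
    (x y : EuclideanSpace ℂ (Fin q)) :
    ⟪l2Tensor q w x, l2Tensor q w' y⟫_ℂ = ⟪w, w'⟫_ℂ * ⟪x, y⟫_ℂ := by
  rw [lp.inner_eq_tsum, lp.inner_eq_tsum, ← tsum_mul_right]
  refine tsum_congr fun n => ?_
  rw [l2Tensor_apply, l2Tensor_apply, inner_smul_left, inner_smul_right, RCLike.inner_apply]
  ring

theorem infAmpliation_l2Tensor {q : ℕ} (B : Matrix (Fin q) (Fin q) ℂ)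
    (w : lp (fun _ : ℕ => ℂ) 2) (x : EuclideanSpace ℂ (Fin q)) :
    infAmpliation B (l2Tensor q w x) = l2Tensor q w (Matrix.toEuclideanCLM (𝕜 := ℂ) B x) := by
  ext1; funext n
  rw [infAmpliation_apply, l2Tensor_apply, l2Tensor_apply, map_smul]

/-- Tensoring on the left with a unit vector of `ℓ²` is an isometry `ℂ^q → ℓ²(ℕ; ℂ^q)`. -/
noncomputable def l2TensorIsometry (q : ℕ) (w : lp (fun _ : ℕ => ℂ) 2) (hw : ‖w‖ = 1) :
    EuclideanSpace ℂ (Fin q) →ₗᵢ[ℂ] L2Copies q :=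
  (l2Tensor q w).isometryOfInner fun x y => by
    rw [inner_l2Tensor, inner_self_eq_norm_sq_to_K, hw]; simp

theorem orthogonalFamily_l2TensorIsometry {q : ℕ} {w : ℕ → lp (fun _ : ℕ => ℂ) 2}
    (hw : Orthonormal ℂ w) :
    OrthogonalFamily ℂ (fun _ : ℕ => EuclideanSpace ℂ (Fin q))
      (fun k => l2TensorIsometry q (w k) (hw.1 k)) := fun k l hkl x y => by
  change ⟪l2Tensor q (w k) x, l2Tensor q (w l) y⟫_ℂ = 0
  rw [inner_l2Tensor, hw.2 hkl, zero_mul]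

/-- The isometry `W ⊗ I_q` of `ℓ²(ℕ; ℂ^q)`, where `W` sends the standard basis of `ℓ²` to the
orthonormal sequence `w`. -/
noncomputable def l2Inflation (q : ℕ) {w : ℕ → lp (fun _ : ℕ => ℂ) 2} (hw : Orthonormal ℂ w) :
    L2Copies q →ₗᵢ[ℂ] L2Copies q :=
  (orthogonalFamily_l2TensorIsometry hw).linearIsometry

theorem hasSum_l2Inflation {q : ℕ} {w : ℕ → lp (fun _ : ℕ => ℂ) 2} (hw : Orthonormal ℂ w)
    (v : L2Copies q) :
    HasSum (fun k => l2Tensor q (w k) (v k)) (l2Inflation q hw v) :=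
  (orthogonalFamily_l2TensorIsometry hw).hasSum_linearIsometry v

/-- `W ⊗ I_q` and `I_∞ ⊗ B` act on different tensor factors, so they commute. -/
theorem infAmpliation_l2Inflation {q : ℕ} (B : Matrix (Fin q) (Fin q) ℂ)
    {w : ℕ → lp (fun _ : ℕ => ℂ) 2} (hw : Orthonormal ℂ w) (v : L2Copies q) :
    infAmpliation B (l2Inflation q hw v) = l2Inflation q hw (infAmpliation B v) := by
  refine ((hasSum_l2Inflation hw v).mapL (infAmpliation B)).unique ?_
  simpa only [infAmpliation_l2Tensor, infAmpliation_apply] using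
    hasSum_l2Inflation hw (infAmpliation B v)

theorem l2Inflation_mem {q : ℕ} {w : ℕ → lp (fun _ : ℕ => ℂ) 2} (hw : Orthonormal ℂ w)
    {N : Submodule ℂ (L2Copies q)} (hN : IsClosed (N : Set (L2Copies q)))
    (h : ∀ k x, l2Tensor q (w k) x ∈ N) (v : L2Copies q) : l2Inflation q hw v ∈ N :=
  hN.mem_of_tendsto (hasSum_l2Inflation hw v)
    (Filter.Eventually.of_forall fun _ => N.sum_mem fun k _ => h k (v k))

theorem exists_orthonormal_nat {E : Type*} [NormedAddCommGroup E] [InnerProductSpace ℂ E]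
    (hE : ¬ FiniteDimensional ℂ E) : ∃ w : ℕ → E, Orthonormal ℂ w := by
  let b := Module.Basis.ofVectorSpace ℂ E
  have : Infinite (Module.Basis.ofVectorSpaceIndex ℂ E) := by
    by_contra h
    rw [not_infinite_iff_finite] at h
    exact hE (Module.Finite.of_basis b)
  exact ⟨_, InnerProductSpace.gramSchmidtNormed_orthonormal
    (b.linearIndependent.comp _ (Infinite.natEmbedding _).injective)⟩

theorem not_finiteDimensional_l2 : ¬ FiniteDimensional ℂ (lp (fun _ : ℕ => ℂ) 2) := by
  intro h
  have hli : LinearIndependent ℂ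
      (fun n : ℕ => (lp.single 2 n (1 : ℂ) : lp (fun _ : ℕ => ℂ) 2)) := by
    refine Orthonormal.linearIndependent ⟨fun n => ?_, fun i j hij => ?_⟩
    · simp [lp.norm_single]
    · change ⟪lp.single 2 i (1 : ℂ), (lp.single 2 j (1 : ℂ) : lp (fun _ : ℕ => ℂ) 2)⟫_ℂ = 0
      rw [lp.inner_single_left]
      simp [hij]
  exact not_finite_iff_infinite.mpr inferInstance hli.finite

/-- Finite codimension of `N` leaves room for `W ⊗ I_q` with range in `N`. -/
theorem exists_orthonormal_l2Tensor_mem {q : ℕ} (N : Submodule ℂ (L2Copies q))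
    [FiniteDimensional ℂ (L2Copies q ⧸ N)] :
    ∃ w : ℕ → lp (fun _ : ℕ => ℂ) 2, Orthonormal ℂ w ∧ ∀ k x, l2Tensor q (w k) x ∈ N := by
  -- The kernel of `Φ` consists of the `w` with `w ⊗ ℂ^q ⊆ N`. It has finite codimension because the
  -- target of `Φ` is finite-dimensional, hence it is infinite-dimensional.
  let Φ : lp (fun _ : ℕ => ℂ) 2 →ₗ[ℂ] EuclideanSpace ℂ (Fin q) →ₗ[ℂ] (L2Copies q ⧸ N) :=
    (l2Tensor q).compr₂ N.mkQ
  have hker : ¬ FiniteDimensional ℂ (LinearMap.ker Φ) := fun h => by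
    have : FiniteDimensional ℂ (lp (fun _ : ℕ => ℂ) 2 ⧸ LinearMap.ker Φ) :=
      Module.Finite.equiv Φ.quotKerEquivRange.symm
    exact not_finiteDimensional_l2 (Module.Finite.of_submodule_quotient (LinearMap.ker Φ))
  obtain ⟨w, hw⟩ := exists_orthonormal_nat hker
  refine ⟨fun k => w k, hw.comp_linearIsometry (LinearMap.ker Φ).subtypeₗᵢ, fun k x => ?_⟩
  have h : Φ (w k) x = 0 := by rw [(w k).2, LinearMap.zero_apply]
  exact (Submodule.Quotient.mk_eq_zero N).mp h

section Compression

variable {H K G : Type*} [NormedAddCommGroup H] [InnerProductSpace ℂ H] [CompleteSpace H]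
  [NormedAddCommGroup K] [InnerProductSpace ℂ K] [CompleteSpace K]
  [NormedAddCommGroup G] [InnerProductSpace ℂ G] [CompleteSpace G]

theorem compression_eq_iff {X : K →ₗᵢ[ℂ] H} {A : H →L[ℂ] H} {B : K →L[ℂ] K} :
    compression X A = B ↔ ∀ u v, ⟪X u, A (X v)⟫_ℂ = ⟪u, B v⟫_ℂ := by
  have h : ∀ u v, ⟪u, compression X A v⟫_ℂ = ⟪X u, A (X v)⟫_ℂ := fun u v =>
    ContinuousLinearMap.adjoint_inner_right X.toContinuousLinearMap u (A (X v))
  refine ⟨fun hB u v => by rw [← h, hB], fun hB => ?_⟩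
  ext v
  exact ext_inner_left ℂ fun u => by rw [h, hB]

theorem compression_comp (Y : K →ₗᵢ[ℂ] H) (X : G →ₗᵢ[ℂ] K) (A : H →L[ℂ] H) :
    compression (Y.comp X) A = compression X (compression Y A) :=
  compression_eq_iff.mpr fun u v => by
    rw [← compression_eq_iff.mp (rfl : compression X (compression Y A) = _),
      ← compression_eq_iff.mp (rfl : compression Y A = _)]
    rfl

theorem compression_l2Inflation {q : ℕ} {w : ℕ → lp (fun _ : ℕ => ℂ) 2}
    (hw : Orthonormal ℂ w) (B : Matrix (Fin q) (Fin q) ℂ) :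
    compression (l2Inflation q hw) (infAmpliation B) = infAmpliation B :=
  compression_eq_iff.mpr fun u v => by
    rw [infAmpliation_l2Inflation, LinearIsometry.inner_map_map]

/-- A tuple in the matricial range is realized by an isometry into any prescribed closed
subspace of finite codimension. -/
theorem exists_isometry_range_le {m q : ℕ} {A : Fin m → H →L[ℂ] H}
    {C : Fin m → Matrix (Fin q) (Fin q) ℂ} (hC : C ∈ matricialRangeInf q A)
    (M : Submodule ℂ H) (hM : IsClosed (M : Set H)) [FiniteDimensional ℂ (H ⧸ M)] :
    ∃ X : L2Copies q →ₗᵢ[ℂ] H,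
      (∀ j, compression X (A j) = infAmpliation (C j)) ∧ ∀ v, X v ∈ M := by
  obtain ⟨X, hX⟩ := hC
  let N : Submodule ℂ (L2Copies q) := M.comap X.toLinearMap
  have hN : IsClosed (N : Set (L2Copies q)) := hM.preimage X.continuous
  have : FiniteDimensional ℂ (L2Copies q ⧸ N) :=
    -- `N` is the full preimage of `M`, so its quotient embeds in `H ⧸ M`.
    Module.Finite.of_injective (N.mapQ M X.toLinearMap le_rfl) (by
      rw [← LinearMap.ker_eq_bot, Submodule.ker_mapQ]
      exact Submodule.mkQ_map_self N)
  obtain ⟨w, hw, hwN⟩ := exists_orthonormal_l2Tensor_mem N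
  refine ⟨X.comp (l2Inflation q hw), fun j => ?_, fun v => l2Inflation_mem hw hN hwN v⟩
  rw [compression_comp, hX, compression_l2Inflation]

theorem matricialRangeInf_compression_subset {m : ℕ} (q : ℕ) (A : Fin m → H →L[ℂ] H)
    (Y : K →ₗᵢ[ℂ] H) :
    matricialRangeInf q (fun j => compression Y (A j)) ⊆ matricialRangeInf q A := by
  rintro C ⟨X, hX⟩
  exact ⟨Y.comp X, fun j => by rw [compression_comp, hX]⟩

theorem finiteDimensional_quotient_of_orthogonal (M : Submodule ℂ H)
    (hM : IsClosed (M : Set H)) [FiniteDimensional ℂ Mᗮ] : FiniteDimensional ℂ (H ⧸ M) := by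
  have : CompleteSpace M := hM.completeSpace_coe
  exact Module.Finite.equiv
    (Submodule.quotientEquivOfIsCompl M Mᗮ (Submodule.isCompl_orthogonal M)).symm

theorem matricialRangeInf_subset_compression {m : ℕ} (q : ℕ) (A : Fin m → H →L[ℂ] H)
    (Y : K →ₗᵢ[ℂ] H) [FiniteDimensional ℂ (LinearMap.range Y.toLinearMap)ᗮ] :
    matricialRangeInf q A ⊆ matricialRangeInf q (fun j => compression Y (A j)) := by
  intro C hC
  have hcl : IsClosed (LinearMap.range Y.toLinearMap : Set H) := by
    rw [LinearMap.coe_range]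
    exact Y.isometry.isClosedEmbedding.isClosed_range
  have := finiteDimensional_quotient_of_orthogonal _ hcl
  obtain ⟨X, hX, hXr⟩ := exists_isometry_range_le hC _ hcl
  -- `Z` is `Y⁻¹ X`, defined because the range of `X` lies in that of `Y`.
  let Z : L2Copies q →ₗᵢ[ℂ] K := Y.equivRange.symm.toLinearIsometry.comp
    { toLinearMap := X.toLinearMap.codRestrict _ hXr
      norm_map' := X.norm_map }
  have hZ : Y.comp Z = X := by
    ext1 v
    exact congrArg Subtype.val (Y.equivRange.apply_symm_apply ⟨X v, hXr v⟩)
  exact ⟨Z, fun j => by rw [← compression_comp, hZ, hX]⟩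

theorem matricialRangeInf_subset_add {m : ℕ} (q : ℕ) (A F : Fin m → H →L[ℂ] H)
    (hF : ∀ j, FiniteDimensional ℂ (LinearMap.range (F j).toLinearMap)) :
    matricialRangeInf q A ⊆ matricialRangeInf q (A + F) := by
  intro C hC
  -- Bundling the `F j` into one map onto finite-dimensional ranges shows that their common kernel
  -- has finite codimension.
  let Ψ : H →ₗ[ℂ] ((j : Fin m) → LinearMap.range (F j).toLinearMap) :=
    LinearMap.pi fun j => (F j).toLinearMap.rangeRestrict
  have hker : ∀ v, v ∈ LinearMap.ker Ψ ↔ ∀ j, F j v = 0 := fun v => by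
    simp [Ψ, funext_iff, Subtype.ext_iff]
  have hcl : IsClosed (LinearMap.ker Ψ : Set H) := by
    have : (LinearMap.ker Ψ : Set H) = ⋂ j, (F j) ⁻¹' {0} := by
      ext v; simp [hker]
    rw [this]
    exact isClosed_iInter fun j => isClosed_singleton.preimage (F j).continuous
  have : FiniteDimensional ℂ (H ⧸ LinearMap.ker Ψ) :=
    Module.Finite.equiv Ψ.quotKerEquivRange.symm
  obtain ⟨X, hX, hXk⟩ := exists_isometry_range_le hC _ hcl
  refine ⟨X, fun j => compression_eq_iff.mpr fun u v => ?_⟩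
  rw [← compression_eq_iff.mp (hX j), Pi.add_apply, add_apply,
    (hker _).mp (hXk v) j, add_zero]

end Compression

theorem corollary3p6 {H : Type*} [NormedAddCommGroup H] [InnerProductSpace ℂ H]
    [CompleteSpace H] (hH : ¬ FiniteDimensional ℂ H)
    (m q : ℕ) (hq : 0 < q)
    (A : Fin m → H →L[ℂ] H) (hA : ∀ j, IsSelfAdjoint (A j))
    (L : Submodule ℂ H) (hL : FiniteDimensional ℂ L)
    (Y₀ : Lᗮ →ₗᵢ[ℂ] H)
    (hY₀ : FiniteDimensional ℂ (LinearMap.range Y₀.toLinearMap)ᗮ)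
    (F₀ : Fin m → H →L[ℂ] H) (hF₀ : ∀ j, IsSelfAdjoint (F₀ j))
    (hF₀_rank : ∀ j, FiniteDimensional ℂ (LinearMap.range (F₀ j).toLinearMap)) :
    matricialRangeInf q A = matricialRangeInf q (fun j => compression Y₀ (A j)) ∧
      matricialRangeInf q (fun j => compression Y₀ (A j)) =
        matricialRangeInf q (A + F₀) := by
  have h₁ : matricialRangeInf q A = matricialRangeInf q (fun j => compression Y₀ (A j)) :=
    (matricialRangeInf_subset_compression q A Y₀).antisymm
      (matricialRangeInf_compression_subset q A Y₀)
  refine ⟨h₁, h₁.symm.trans ((matricialRangeInf_subset_add q A F₀ hF₀_rank).antisymm ?_)⟩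
  -- The reverse inclusion perturbs `A + F₀` by `-F₀`, again of finite rank.
  have h := matricialRangeInf_subset_add q (A + F₀) (-F₀) fun j => by
    rw [Pi.neg_apply, ContinuousLinearMap.toLinearMap_neg, LinearMap.range_neg]
    exact hF₀_rank j
  rwa [add_neg_cancel_right] at h
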